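/- Let $n\in\mathbb{N}$, $M\in\mathbb{R}^{n\times n}$ a cost matrix, $\lambda>0$ and $\epsilon>0$. Let $\Delta_n=\{p\in\mathbb{R}^n : p_i\ge 0 \text{ for all } i,\ \sum_i p_i=1\}$ and $\Delta_n^\epsilon=\{p\in\Delta_n : p_i\ge\epsilon \text{ for all } i\}$. For $a,b\in\Delta_n$ let $$\Pi(a,b)=\Big\{T\in\mathbb{R}^{n\times n} : T_{ij}\ge 0,\ \sum_j T_{ij}=a_i,\ \sum_i T_{ij}=b_j\Big\},\qquad h(T)=-\sum_{i,j}T_{ij}(\log T_{ij}-1),$$ with $0\log 0=0$, and $\langle T,M\rangle=\mathrm{Tr}(T^\top M)$. The regularized Sinkhorn loss and the sharp Sinkhorn loss are $$\widetilde{\mathrm S}_\lambda(a,b)=\min_{T\in\Pi(a,b)}\langle T,M\rangle-\tfrac1\lambda h(T),\qquad \mathrm S_\lambda(a,b)=\langle T_\lambda,M\rangle,\quad T_\lambda=\operatorname*{argmin}_{T\in\Pi(a,b)}\langle T,M\rangle-\tfrac1\lambda h(T)$$ (the minimizer $T_\lambda=T_\lambda(a,b)$ exists and is unique). A function $\mathcal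 S:\mathcal Y\times\mathcal Y\to\mathbb{R}$ on a topological space $\mathcal Y$ is a Structure Encoding Loss Function (SELF) if there exist a separable real Hilbert space $\mathcal H$, a continuous map $\psi:\mathcal Y\to\mathcal H$ and a bounded linear operator $V:\mathcal H\to\mathcal H$ such that $\mathcal S(y,y')=\langle\psi(y),V\psi(y')\rangle_{\mathcal H}$ for all $y,y'\in\mathcal Y$. Then both $\widetilde{\mathrm S}_\lambda$ and $\mathrm S_\lambda$, restricted to $\Delta_n^\epsilon\times\Delta_n^\epsilon$, are SELF (with $\mathcal Y=\Delta_n^\epsilon$ carrying the Euclidean topology). -/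

import Mathlib

noncomputable section

namespace Sinkhorn

/-- The truncated simplex: the points of the probability simplex all of whose coordinates
are at least `ε`. -/
def truncSimplex (n : ℕ) (ε : ℝ) : Set (Fin n → ℝ) :=
  {p | p ∈ stdSimplex ℝ (Fin n) ∧ ∀ i, ε ≤ p i}

/-- The transportation polytope `Π(a, b)`: matrices with non-negative entries, row sums `a` and
column sums `b`. -/
def transportPolytope {n m : ℕ} (a : Fin n → ℝ) (b : Fin m → ℝ) :
    Set (Matrix (Fin n) (Fin m) ℝ) :=
  {T | (∀ i j, 0 ≤ T i j) ∧ (∀ i, ∑ j, T i j = a i) ∧ (∀ j, ∑ i, T i j = b j)}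

/-- The Frobenius product `Tr(Tᵀ M)`. -/
def frobenius {n m : ℕ} (T M : Matrix (Fin n) (Fin m) ℝ) : ℝ :=
  (T.transpose * M).trace

/-- The entropy `h(T) = - ∑ T_ij (log T_ij - 1)`, with the usual convention `0 log 0 = 0`. -/
def entropy {n m : ℕ} (T : Matrix (Fin n) (Fin m) ℝ) : ℝ :=
  -∑ i, ∑ j, T i j * (Real.log (T i j) - 1)

/-- The entropically regularized transport objective `⟨T, M⟩ - (1/λ) h(T)`. -/
def regObjective {n m : ℕ} (M : Matrix (Fin n) (Fin m) ℝ) (lam : ℝ)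
    (T : Matrix (Fin n) (Fin m) ℝ) : ℝ :=
  frobenius T M - (1 / lam) * entropy T

/-- `T` is a minimizer of the regularized objective over `Π(a, b)`. -/
def IsOptimalPlan {n m : ℕ} (M : Matrix (Fin n) (Fin m) ℝ) (lam : ℝ)
    (a : Fin n → ℝ) (b : Fin m → ℝ) (T : Matrix (Fin n) (Fin m) ℝ) : Prop :=
  T ∈ transportPolytope a b ∧ IsMinOn (regObjective M lam) (transportPolytope a b) T

/-- The optimal plan `T_λ`. For `λ > 0` and `a`, `b` in the simplices it is the unique minimizer,
see `existsUnique_isOptimalPlan` and `isOptimalPlan_plan` below. -/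
def plan {n m : ℕ} (M : Matrix (Fin n) (Fin m) ℝ) (lam : ℝ)
    (a : Fin n → ℝ) (b : Fin m → ℝ) : Matrix (Fin n) (Fin m) ℝ :=
  Classical.epsilon (IsOptimalPlan M lam a b)

/-- The regularized Sinkhorn loss: the minimum of the regularized objective over `Π(a, b)`.
The minimum is attained, see `isLeast_regularizedSinkhorn` below. -/
def regularizedSinkhorn {n m : ℕ} (M : Matrix (Fin n) (Fin m) ℝ) (lam : ℝ)
    (a : Fin n → ℝ) (b : Fin m → ℝ) : ℝ :=
  sInf (regObjective M lam '' transportPolytope a b)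

/-- The sharp Sinkhorn loss `⟨T_λ, M⟩`. -/
def sharpSinkhorn {n m : ℕ} (M : Matrix (Fin n) (Fin m) ℝ) (lam : ℝ)
    (a : Fin n → ℝ) (b : Fin m → ℝ) : ℝ :=
  frobenius (plan M lam a b) M

/-- Structure Encoding Loss Function on a topological space `Y`. (Every separable Hilbert
space is isometric to one living in `Type`, so the universe of `H` is no restriction.) -/
def IsSELF {Y : Type*} [TopologicalSpace Y] (S : Y → Y → ℝ) : Prop :=
  ∃ (H : Type) (_ : NormedAddCommGroup H) (_ : InnerProductSpace ℝ H) (_ : CompleteSpace H)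
    (_ : TopologicalSpace.SeparableSpace H) (ψ : Y → H) (V : H →L[ℝ] H),
    Continuous ψ ∧ ∀ y y' : Y, S y y' = inner ℝ (ψ y) (V (ψ y'))

/-! Well-definedness of the two losses. -/

theorem regObjective_eq {n m : ℕ} (M : Matrix (Fin n) (Fin m) ℝ) (lam : ℝ)
    (T : Matrix (Fin n) (Fin m) ℝ) :
    regObjective M lam T = ∑ i, ∑ j,
      (T i j * (M i j - 1 / lam) + (1 / lam) * (T i j * Real.log (T i j))) := by
  have h : frobenius T M = ∑ i, ∑ j, T i j * M i j := by
    simp only [frobenius, Matrix.trace, Matrix.diag, Matrix.mul_apply, Matrix.transpose_apply]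
    exact Finset.sum_comm
  rw [regObjective, h, entropy, mul_neg, sub_neg_eq_add, Finset.mul_sum, ← Finset.sum_add_distrib]
  refine Finset.sum_congr rfl fun i _ => ?_
  rw [Finset.mul_sum, ← Finset.sum_add_distrib]
  exact Finset.sum_congr rfl fun j _ => by ring

theorem continuous_regObjective {n m : ℕ} (M : Matrix (Fin n) (Fin m) ℝ) (lam : ℝ) :
    Continuous (regObjective M lam) := by
  have h : regObjective M lam = fun T => ∑ i, ∑ j,
      (T i j * (M i j - 1 / lam) + (1 / lam) * (T i j * Real.log (T i j))) :=
    funext (regObjective_eq M lam)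
  rw [h]
  refine continuous_finsetSum _ fun i _ => continuous_finsetSum _ fun j _ => ?_
  have hT : Continuous fun T : Matrix (Fin n) (Fin m) ℝ => T i j := continuous_id.matrix_elem i j
  exact (hT.mul continuous_const).add (continuous_const.mul (Real.continuous_mul_log.comp hT))

theorem isCompact_transportPolytope {n m : ℕ} (a : Fin n → ℝ) (b : Fin m → ℝ) :
    IsCompact (transportPolytope a b) := by
  have he : ∀ i j, Continuous fun T : Matrix (Fin n) (Fin m) ℝ => T i j :=
    fun i j => continuous_id.matrix_elem i j
  have hclosed : IsClosed (transportPolytope a b) := by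
    refine IsClosed.inter (s₁ := {T : Matrix (Fin n) (Fin m) ℝ | ∀ i j, 0 ≤ T i j}) ?_
      (IsClosed.inter (s₁ := {T : Matrix (Fin n) (Fin m) ℝ | ∀ i, ∑ j, T i j = a i})
        (s₂ := {T : Matrix (Fin n) (Fin m) ℝ | ∀ j, ∑ i, T i j = b j}) ?_ ?_)
    · simp only [Set.ofPred_forall]
      exact isClosed_iInter fun i => isClosed_iInter fun j => isClosed_le continuous_const (he i j)
    · simp only [Set.ofPred_forall]
      exact isClosed_iInter fun i => isClosed_eq
        (continuous_finsetSum _ fun j _ => he i j) continuous_const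
    · simp only [Set.ofPred_forall]
      exact isClosed_iInter fun j => isClosed_eq
        (continuous_finsetSum _ fun i _ => he i j) continuous_const
  have hbox : IsCompact (Set.univ.pi fun i : Fin n => Set.univ.pi fun _ : Fin m =>
      Set.Icc (0 : ℝ) (a i)) :=
    isCompact_univ_pi fun i => isCompact_univ_pi fun _ => isCompact_Icc
  refine IsCompact.of_isClosed_subset hbox hclosed ?_
  intro T hT i _ j _
  refine ⟨hT.1 i j, ?_⟩
  rw [← hT.2.1 i]
  exact Finset.single_le_sum (f := fun j => T i j) (fun j _ => hT.1 i j) (Finset.mem_univ j)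

theorem transportPolytope_nonempty {n m : ℕ} {a : Fin n → ℝ} {b : Fin m → ℝ}
    (ha : a ∈ stdSimplex ℝ (Fin n)) (hb : b ∈ stdSimplex ℝ (Fin m)) :
    (transportPolytope a b).Nonempty := by
  refine ⟨Matrix.of fun i j => a i * b j, fun i j => mul_nonneg (ha.1 i) (hb.1 j),
    fun i => ?_, fun j => ?_⟩
  · simp only [Matrix.of_apply]
    rw [← Finset.mul_sum, hb.2, mul_one]
  · simp only [Matrix.of_apply]
    rw [← Finset.sum_mul, ha.2, one_mul]

theorem existsUnique_isOptimalPlan {n m : ℕ} (M : Matrix (Fin n) (Fin m) ℝ) {lam : ℝ}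
    (hlam : 0 < lam) {a : Fin n → ℝ} {b : Fin m → ℝ}
    (ha : a ∈ stdSimplex ℝ (Fin n)) (hb : b ∈ stdSimplex ℝ (Fin m)) :
    ∃! T, IsOptimalPlan M lam a b T := by
  obtain ⟨T, hT, hmin⟩ := (isCompact_transportPolytope a b).exists_isMinOn
    (transportPolytope_nonempty ha hb) (continuous_regObjective M lam).continuousOn
  refine ⟨T, ⟨hT, hmin⟩, ?_⟩
  rintro T' ⟨hT', hmin'⟩
  by_contra hne
  have hl : (0 : ℝ) < 1 / lam := by positivity
  have hval : regObjective M lam T' = regObjective M lam T := le_antisymm (hmin' hT) (hmin hT')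
  set U : Matrix (Fin n) (Fin m) ℝ :=
    Matrix.of fun i j => (1 / 2 : ℝ) * T i j + (1 / 2 : ℝ) * T' i j with hU
  have hUmem : U ∈ transportPolytope a b := by
    refine ⟨fun i j => ?_, fun i => ?_, fun j => ?_⟩
    · have h1 := hT.1 i j
      have h2 := hT'.1 i j
      simp only [hU, Matrix.of_apply]
      positivity
    · simp only [hU, Matrix.of_apply, Finset.sum_add_distrib, ← Finset.mul_sum, hT.2.1, hT'.2.1]
      ring
    · simp only [hU, Matrix.of_apply, Finset.sum_add_distrib, ← Finset.mul_sum, hT.2.2, hT'.2.2]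
      ring
  set f : ℝ → ℝ → ℝ := fun c x => x * c + (1 / lam) * (x * Real.log x) with hf
  have hle : ∀ c x y : ℝ, 0 ≤ x → 0 ≤ y →
      f c (1 / 2 * x + 1 / 2 * y) ≤ 1 / 2 * f c x + 1 / 2 * f c y := by
    intro c x y hx hy
    have h := Real.strictConvexOn_mul_log.convexOn.2 (Set.mem_Ici.2 hx) (Set.mem_Ici.2 hy)
      (by norm_num : (0 : ℝ) ≤ 1 / 2) (by norm_num : (0 : ℝ) ≤ 1 / 2) (by norm_num)
    simp only [smul_eq_mul] at h
    have h' := mul_le_mul_of_nonneg_left h hl.le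
    simp only [hf]
    linarith
  have hlt : ∀ c x y : ℝ, 0 ≤ x → 0 ≤ y → x ≠ y →
      f c (1 / 2 * x + 1 / 2 * y) < 1 / 2 * f c x + 1 / 2 * f c y := by
    intro c x y hx hy hxy
    have h := Real.strictConvexOn_mul_log.2 (Set.mem_Ici.2 hx) (Set.mem_Ici.2 hy) hxy
      (by norm_num : (0 : ℝ) < 1 / 2) (by norm_num : (0 : ℝ) < 1 / 2) (by norm_num)
    simp only [smul_eq_mul] at h
    have h' := mul_lt_mul_of_pos_left h hl
    simp only [hf]
    linarith
  obtain ⟨i₀, j₀, hij⟩ : ∃ i j, T i j ≠ T' i j := by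
    by_contra! hcon
    exact hne (Matrix.ext fun i j => (hcon i j).symm)
  have hsum : regObjective M lam U <
      1 / 2 * regObjective M lam T + 1 / 2 * regObjective M lam T' := by
    rw [regObjective_eq, regObjective_eq, regObjective_eq, Finset.mul_sum, Finset.mul_sum,
      ← Finset.sum_add_distrib]
    simp only [Finset.mul_sum (s := (Finset.univ : Finset (Fin m))), ← Finset.sum_add_distrib]
    refine Finset.sum_lt_sum (fun i _ => Finset.sum_le_sum fun j _ => ?_)
      ⟨i₀, Finset.mem_univ _, Finset.sum_lt_sum (fun j _ => ?_) ⟨j₀, Finset.mem_univ _, ?_⟩⟩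
    · exact hle (M i j - 1 / lam) _ _ (hT.1 i j) (hT'.1 i j)
    · exact hle (M i₀ j - 1 / lam) _ _ (hT.1 i₀ j) (hT'.1 i₀ j)
    · exact hlt (M i₀ j₀ - 1 / lam) _ _ (hT.1 i₀ j₀) (hT'.1 i₀ j₀) hij
  have hUmin : regObjective M lam T ≤ regObjective M lam U := hmin hUmem
  linarith

theorem isOptimalPlan_plan {n m : ℕ} (M : Matrix (Fin n) (Fin m) ℝ) {lam : ℝ}
    (hlam : 0 < lam) {a : Fin n → ℝ} {b : Fin m → ℝ}
    (ha : a ∈ stdSimplex ℝ (Fin n)) (hb : b ∈ stdSimplex ℝ (Fin m)) :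
    IsOptimalPlan M lam a b (plan M lam a b) :=
  Classical.epsilon_spec (existsUnique_isOptimalPlan M hlam ha hb).exists

theorem isLeast_regularizedSinkhorn {n m : ℕ} (M : Matrix (Fin n) (Fin m) ℝ) {lam : ℝ}
    (hlam : 0 < lam) {a : Fin n → ℝ} {b : Fin m → ℝ}
    (ha : a ∈ stdSimplex ℝ (Fin n)) (hb : b ∈ stdSimplex ℝ (Fin m)) :
    IsLeast (regObjective M lam '' transportPolytope a b) (regularizedSinkhorn M lam a b) := by
  have h := isOptimalPlan_plan M hlam ha hb
  have hl : IsLeast (regObjective M lam '' transportPolytope a b)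
      (regObjective M lam (plan M lam a b)) := by
    refine ⟨⟨_, h.1, rfl⟩, ?_⟩
    rintro _ ⟨T, hT, rfl⟩
    exact h.2 hT
  rw [regularizedSinkhorn, hl.csInf_eq]
  exact hl

end Sinkhorn

end

/-!
Both losses are analytic functions of the pair `(a, b)` on the truncated simplex, and a kernel on
a compact metric space that is locally analytic in continuous coordinates is a structure encoding
loss.

*From analytic to Hilbert space.* A monomial in the coordinates of `(a, b)` is a function of `a`
times a function of `b`. Near a point, the Taylor series of an analytic function is therefore a
rapidly convergent series `∑ f i a * g i b`, that is, the inner product in `ℓ²` of two continuous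
feature maps (`HilbertFactorable.exists_eventually_eq_of_analyticAt`). The feature maps need only
be continuous, so a continuous partition of unity on the compact simplex glues these local
factorizations together (`HilbertFactorable.of_locally`). Two feature maps `φ`, `χ` become the
single one `(φ, χ)`, with the operator that exchanges the coordinates
(`HilbertFactorable.isSELF`).

*Analyticity of the optimal plan.* By Gibbs' inequality, a matrix `exp (x i + y j - λ M i j)` is
the optimal plan between its own marginals (`Sinkhorn.isOptimalPlan_gibbsPlan`). The map from
`(x, y)` to the marginals is invariant under `(x + c, y - c)`; the addition of the gauge
`∑ x i - ∑ y j` to the row sums and its subtraction from the column sums remove the degeneracy,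
and do not change the solutions, since `a` and `b` have the same mass. The corrected map is the
gradient of a strictly convex function. For positive marginals a solution exists because the dual
objective is coercive (`Sinkhorn.tendsto_dualObjective`), and the analytic inverse function
theorem makes the potentials analytic in `(a, b)`
(`Sinkhorn.exists_analyticAt_rightInverse_marginalMap`). Both losses are analytic in the
potentials.
-/

open Filter Topology
open scoped ContDiff

/-! ### Kernels that factor through a Hilbert space -/

/-- A two-variable kernel factors through a Hilbert space when it is the inner product
`⟨φ x, χ y⟩` of two continuous feature maps into a common real Hilbert space. -/
def HilbertFactorable {X Y : Type*} [TopologicalSpace X] [TopologicalSpace Y]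
    (S : X → Y → ℝ) : Prop :=
  ∃ (H : Type) (_ : NormedAddCommGroup H) (_ : InnerProductSpace ℝ H) (_ : CompleteSpace H)
    (φ : X → H) (χ : Y → H), Continuous φ ∧ Continuous χ ∧ ∀ x y, S x y = inner ℝ (φ x) (χ y)

/-- Continuous functions dominated by the terms of a convergent series are the coordinates of a
continuous map into `ℓ²`: the series `∑ f i x • e i` converges uniformly. -/
theorem exists_continuous_lp_two {ι : Type} {X : Type*} [TopologicalSpace X] {f : ι → X → ℝ}
    {u : ι → ℝ} (hf : ∀ i, Continuous (f i)) (hu : Summable u) (hfu : ∀ i x, |f i x| ≤ u i) :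
    ∃ φ : X → lp (fun _ : ι => ℝ) 2, Continuous φ ∧ ∀ x i, φ x i = f i x := by
  classical
  have hle : ∀ i x, ‖lp.single (E := fun _ : ι => ℝ) 2 i (f i x)‖ ≤ u i := fun i x => by
    rw [lp.norm_single (by norm_num)]
    exact hfu i x
  refine ⟨fun x => ∑' i, lp.single (E := fun _ : ι => ℝ) 2 i (f i x),
    continuous_tsum (fun i => ?_) hu hle, fun x i => ?_⟩
  · exact (lp.isometry_single (E := fun _ : ι => ℝ) (p := 2) i).continuous.comp (hf i)
  · have hs : HasSum (fun i => lp.single (E := fun _ : ι => ℝ) 2 i (f i x)) _ :=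
      (Summable.of_norm_bounded hu (hle · x)).hasSum
    have h1 := hs.mapL (lp.evalCLM ℝ (fun _ : ι => ℝ) 2 i)
    have h2 := hasSum_single (f := fun j => lp.single (E := fun _ : ι => ℝ) 2 j (f j x) i) i
      (fun j hj => lp.single_apply_ne 2 j _ hj.symm)
    rw [lp.single_apply_self] at h2
    exact h1.unique h2

namespace HilbertFactorable

variable {X Y : Type*} [TopologicalSpace X] [TopologicalSpace Y]

theorem zero : HilbertFactorable (fun (_ : X) (_ : Y) => (0 : ℝ)) :=
  ⟨ℝ, inferInstance, inferInstance, inferInstance, fun _ => 0, fun _ => 0,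
    continuous_const, continuous_const, fun _ _ => by simp⟩

theorem add {S T : X → Y → ℝ} (hS : HilbertFactorable S) (hT : HilbertFactorable T) :
    HilbertFactorable (fun x y => S x y + T x y) := by
  obtain ⟨H, _, _, _, φ, χ, hφ, hχ, h⟩ := hS
  obtain ⟨H', _, _, _, φ', χ', hφ', hχ', h'⟩ := hT
  refine ⟨WithLp 2 (H × H'), inferInstance, inferInstance, inferInstance,
    fun x => WithLp.toLp 2 (φ x, φ' x), fun y => WithLp.toLp 2 (χ y, χ' y), ?_, ?_, ?_⟩
  · exact (WithLp.prod_continuous_toLp 2 H H').comp (hφ.prodMk hφ')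
  · exact (WithLp.prod_continuous_toLp 2 H H').comp (hχ.prodMk hχ')
  · intro x y
    simp [h, h', WithLp.prod_inner_apply]

theorem sum {ι : Type*} (s : Finset ι) {S : ι → X → Y → ℝ} (h : ∀ i ∈ s, HilbertFactorable (S i)) :
    HilbertFactorable (fun x y => ∑ i ∈ s, S i x y) := by
  classical
  induction s using Finset.induction_on with
  | empty => simpa using zero
  | insert i s hi ih =>
    simp only [Finset.sum_insert hi]
    exact (h i (Finset.mem_insert_self _ _)).add
      (ih fun j hj => h j (Finset.mem_insert_of_mem hj))

theorem mul_mul {S : X → Y → ℝ} (hS : HilbertFactorable S) {f : X → ℝ} {g : Y → ℝ}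
    (hf : Continuous f) (hg : Continuous g) :
    HilbertFactorable (fun x y => f x * g y * S x y) := by
  obtain ⟨H, _, _, _, φ, χ, hφ, hχ, h⟩ := hS
  refine ⟨H, inferInstance, inferInstance, inferInstance, fun x => f x • φ x,
    fun y => g y • χ y, hf.smul hφ, hg.smul hχ, fun x y => ?_⟩
  simp only [h, real_inner_smul_left, real_inner_smul_right]
  ring

/-- A series of products of continuous functions, each factor bounded by the terms of a
convergent series, factors through `ℓ²`. -/
theorem of_hasSum {ι : Type} {f : ι → X → ℝ} {g : ι → Y → ℝ} {u v : ι → ℝ} {S : X → Y → ℝ}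
    (hf : ∀ i, Continuous (f i)) (hg : ∀ i, Continuous (g i)) (hu : Summable u) (hv : Summable v)
    (hfu : ∀ i x, |f i x| ≤ u i) (hgv : ∀ i y, |g i y| ≤ v i)
    (hS : ∀ x y, HasSum (fun i => f i x * g i y) (S x y)) : HilbertFactorable S := by
  obtain ⟨φ, hφ, hφ'⟩ := exists_continuous_lp_two hf hu hfu
  obtain ⟨χ, hχ, hχ'⟩ := exists_continuous_lp_two hg hv hgv
  refine ⟨lp (fun _ : ι => ℝ) 2, inferInstance, inferInstance, inferInstance, φ, χ, hφ, hχ,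
    fun x y => (hS x y).unique ?_⟩
  have := lp.hasSum_inner (𝕜 := ℝ) (φ x) (χ y)
  simpa [hφ', hχ', mul_comm] using this

/-- Factorability is a local property over a compact base: continuous partitions of unity
suffice, since feature maps are only required to be continuous. -/
theorem of_locally {Y : Type*} [MetricSpace Y] [CompactSpace Y] {S : Y → Y → ℝ}
    (h : ∀ z : Y × Y, ∃ T : Y → Y → ℝ, HilbertFactorable T ∧ ∀ᶠ w in 𝓝 z, S w.1 w.2 = T w.1 w.2) :
    HilbertFactorable S := by
  choose T hT hST using h
  obtain ⟨δ, hδ, hball⟩ := lebesgue_number_lemma_of_metric (s := (Set.univ : Set (Y × Y)))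
    (c := fun z => interior {w : Y × Y | S w.1 w.2 = T z w.1 w.2}) isCompact_univ
    (fun z => isOpen_interior)
    (fun z _ => Set.mem_iUnion.2 ⟨z, mem_interior_iff_mem_nhds.2 (hST z)⟩)
  obtain ⟨t, ht⟩ := isCompact_univ.elim_finite_subcover (fun y : Y => Metric.ball y δ)
    (fun _ => Metric.isOpen_ball)
    (fun y _ => Set.mem_iUnion.2 ⟨y, Metric.mem_ball_self hδ⟩)
  obtain ⟨ρ, hρ⟩ := PartitionOfUnity.exists_isSubordinate isClosed_univ
    (fun y : t => Metric.ball (y : Y) δ) (fun _ => Metric.isOpen_ball) (by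
      intro y hy
      obtain ⟨i, hi, hyi⟩ := Set.mem_iUnion₂.1 (ht hy)
      exact Set.mem_iUnion.2 ⟨⟨i, hi⟩, hyi⟩)
  choose c hc using fun z : Y × Y => hball z (Set.mem_univ z)
  have hone : ∀ y, ∑ i, ρ i y = 1 := fun y => by
    rw [← finsum_eq_sum_of_fintype]
    exact ρ.sum_eq_one (Set.mem_univ y)
  have hS : S = fun x y => ∑ p : t × t, ρ p.1 x * ρ p.2 y * T (c (p.1, p.2)) x y := by
    funext x y
    have h1 : S x y = ∑ p : t × t, ρ p.1 x * ρ p.2 y * S x y := by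
      rw [← Finset.sum_mul, Fintype.sum_prod_type]
      simp only [← Finset.mul_sum, hone, mul_one, one_mul]
    rw [h1]
    refine Finset.sum_congr rfl fun p _ => ?_
    by_cases hx : ρ p.1 x = 0
    · simp [hx]
    by_cases hy : ρ p.2 y = 0
    · simp [hy]
    have hx' := hρ p.1 (subset_tsupport _ hx)
    have hy' := hρ p.2 (subset_tsupport _ hy)
    have hxy : ((x, y) : Y × Y) ∈ Metric.ball ((p.1, p.2) : Y × Y) δ := by
      rw [← ball_prod_same]
      exact ⟨hx', hy'⟩
    have := interior_subset (hc _ hxy)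
    rw [Set.mem_ofPred_eq] at this
    rw [this]
  rw [hS]
  exact sum _ fun p _ => (hT _).mul_mul (ρ p.1).continuous (ρ p.2).continuous

/-- A kernel with two feature maps is a structure encoding loss: the two maps are put side by
side, and the operator exchanges the two coordinates. The closed span of the range of the
combined feature map is separable, which makes separability automatic. -/
theorem isSELF [TopologicalSpace.SeparableSpace Y] {S : Y → Y → ℝ} (hS : HilbertFactorable S) :
    Sinkhorn.IsSELF S := by
  obtain ⟨H, _, _, _, φ, χ, hφ, hχ, h⟩ := hS
  let ψ : Y → WithLp 2 (H × H) := fun y => WithLp.toLp 2 (φ y, χ y)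
  have hψ : Continuous ψ := (WithLp.prod_continuous_toLp 2 H H).comp (hφ.prodMk hχ)
  let V : WithLp 2 (H × H) →L[ℝ] WithLp 2 (H × H) :=
    (WithLp.prodContinuousLinearEquiv 2 ℝ H H).symm.toContinuousLinearMap ∘L
      (ContinuousLinearMap.inl ℝ H H ∘L ContinuousLinearMap.snd ℝ H H) ∘L
      (WithLp.prodContinuousLinearEquiv 2 ℝ H H).toContinuousLinearMap
  let K : Submodule ℝ (WithLp 2 (H × H)) := (Submodule.span ℝ (Set.range ψ)).topologicalClosure
  have hK : ∀ y, ψ y ∈ K := fun y =>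
    Submodule.le_topologicalClosure _ (Submodule.subset_span ⟨y, rfl⟩)
  have : CompleteSpace K := (Submodule.isClosed_topologicalClosure _).completeSpace_coe
  have hsep : TopologicalSpace.SeparableSpace K :=
    (TopologicalSpace.isSeparable_range hψ).span.closure.separableSpace
  refine ⟨K, inferInstance, inferInstance, inferInstance, hsep, fun y => ⟨ψ y, hK y⟩,
    K.orthogonalProjectionOnto ∘L V ∘L K.subtypeL, hψ.subtype_mk _, fun y y' => ?_⟩
  have : inner ℝ (ψ y) (V (ψ y')) = inner ℝ (φ y) (χ y') := by
    simp [V, ψ, WithLp.prod_inner_apply]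
  rw [h, ← this]
  simp

end HilbertFactorable

/-! ### Analytic kernels -/

/-- The Taylor series in coordinates, indexed by words in the coordinates rather than by
multi-indices, so that multilinear expansion of each homogeneous term needs no regrouping. -/
theorem FormalMultilinearSeries.hasSum_sigma_coord {ι : Type*} [Fintype ι] [DecidableEq ι]
    {f : (ι → ℝ) → ℝ} {p : FormalMultilinearSeries ℝ (ι → ℝ) ℝ} {z h : ι → ℝ}
    (hs : Summable fun e : Σ n : ℕ, (Fin n → ι) =>
      p e.1 (fun k => Pi.single (e.2 k) 1) * ∏ k, h (e.2 k))
    (hp : HasSum (fun n => p n fun _ => h) (f (z + h))) :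
    HasSum (fun e : Σ n : ℕ, (Fin n → ι) =>
      p e.1 (fun k => Pi.single (e.2 k) 1) * ∏ k, h (e.2 k)) (f (z + h)) := by
  have hh : h = ∑ i, h i • (Pi.single i 1 : ι → ℝ) := by
    conv_lhs => rw [← Finset.univ_sum_single h]
    simp [← Pi.single_smul]
  have h1 := hs.hasSum.sigma fun n => hasSum_fintype _
  have h2 : ∀ n, ∑ s : Fin n → ι, p n (fun k => Pi.single (s k) 1) * ∏ k, h (s k) =
      p n fun _ => h := fun n => by
    conv_rhs => rw [hh]
    rw [ContinuousMultilinearMap.map_sum]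
    refine Finset.sum_congr rfl fun s _ => ?_
    rw [ContinuousMultilinearMap.map_smul_univ, smul_eq_mul, mul_comm]
  simp only [h2] at h1
  rw [← h1.unique hp]
  exact hs.hasSum

/-- The words over a finite alphabet with `d` letters, weighted geometrically with a ratio `q`
such that `d q < 1`, have finite total weight. -/
theorem summable_sigma_fin_pow {ι : Type*} [Fintype ι] {q : ℝ} (hq : 0 ≤ q)
    (hq' : Fintype.card ι * q < 1) :
    Summable fun e : Σ n : ℕ, (Fin n → ι) => q ^ e.1 := by
  rw [summable_sigma_of_nonneg fun e => by positivity]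
  refine ⟨fun n => (hasSum_fintype _).summable, ?_⟩
  have : ∀ n : ℕ, ∑' _ : Fin n → ι, q ^ n = (Fintype.card ι * q) ^ n := fun n => by
    rw [tsum_fintype]
    simp [mul_pow]
  simp only [this]
  exact summable_geometric_of_lt_one (by positivity) hq'

/-- An analytic function of finitely many continuous coordinates of `x` and of `y` factors
through a Hilbert space near each point: the monomials of its Taylor series split into a function
of `x` times a function of `y`, and the coefficients decay geometrically on a small box. -/
theorem HilbertFactorable.exists_eventually_eq_of_analyticAt {X Y : Type*} [TopologicalSpace X]
    [TopologicalSpace Y] {ι κ : Type} [Fintype ι] [Fintype κ] {a : X → ι → ℝ} {b : Y → κ → ℝ}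
    (ha : Continuous a) (hb : Continuous b) {f : (ι ⊕ κ → ℝ) → ℝ} {x₀ : X} {y₀ : Y}
    (hf : AnalyticAt ℝ f (Sum.elim (a x₀) (b y₀))) :
    ∃ T : X → Y → ℝ, HilbertFactorable T ∧
      ∀ᶠ w in 𝓝 (x₀, y₀), f (Sum.elim (a w.1) (b w.2)) = T w.1 w.2 := by
  classical
  obtain ⟨p, r, hp⟩ := hf
  obtain ⟨r', hr'0, hr'⟩ := ENNReal.lt_iff_exists_nnreal_btwn.1 hp.r_pos
  have hr'0 : (0 : ℝ) < r' := by exact_mod_cast hr'0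
  obtain ⟨C, hC, hpC⟩ := p.norm_le_div_pow_of_pos_of_lt_radius (by exact_mod_cast hr'0)
    (hr'.trans_le hp.r_le)
  set q : ℝ := 1 / (Fintype.card (ι ⊕ κ) + 1) with hq
  have hq0 : 0 < q := by positivity
  have hq1 : q ≤ 1 := by
    rw [hq, div_le_one (by positivity)]
    linarith [(Nat.cast_nonneg (Fintype.card (ι ⊕ κ)) : (0 : ℝ) ≤ _)]
  have hdq : Fintype.card (ι ⊕ κ) * q < 1 := by
    rw [hq, mul_one_div, div_lt_one (by positivity)]
    linarith
  -- One factor `q` of the side of the box makes the functions of `x` summable, the other one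
  -- those of `y`.
  set δ : ℝ := r' * q * q with hδ
  have hδ0 : 0 < δ := by positivity
  have hδr : δ ≤ r' := by
    rw [hδ, mul_assoc]
    exact mul_le_of_le_one_right hr'0.le (mul_le_one₀ hq1 hq0.le hq1)
  -- Clamping the rescaled coordinates turns the Taylor series into a global function.
  set cl : ℝ → ℝ := fun t => max (-1) (min 1 t) with hcl
  have hclc : Continuous cl := by fun_prop
  have hcl1 : ∀ t, |cl t| ≤ 1 := fun t => by
    rw [abs_le]
    exact ⟨le_max_left _ _, max_le (by norm_num) (min_le_left _ _)⟩
  have hclid : ∀ t, |t| ≤ 1 → cl t = t := fun t ht => by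
    rw [abs_le] at ht
    simp only [hcl]
    rw [min_eq_right ht.2, max_eq_right ht.1]
  set u : X → ι → ℝ := fun x i => cl ((a x i - a x₀ i) / δ) with hu
  set v : Y → κ → ℝ := fun y j => cl ((b y j - b y₀ j) / δ) with hv
  have hui : ∀ i, Continuous fun x => u x i := fun i => by
    have := (continuous_apply i).comp ha
    exact hclc.comp (by simpa using (this.sub continuous_const).div_const δ)
  have hvj : ∀ j, Continuous fun y => v y j := fun j => by
    have := (continuous_apply j).comp hb
    exact hclc.comp (by simpa using (this.sub continuous_const).div_const δ)
  set w : X → Y → ι ⊕ κ → ℝ := fun x y => Sum.elim (u x) (v y) with hw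
  set z₀ := Sum.elim (a x₀) (b y₀) with hz₀
  let U : X → ι ⊕ κ → ℝ := fun x => Sum.elim (u x) (fun _ => 1)
  let W : Y → ι ⊕ κ → ℝ := fun y => Sum.elim (fun _ => 1) (v y)
  have hUW : ∀ x y k, w x y k = U x k * W y k := by
    rintro x y (i | j) <;> simp [U, W, hw]
  have hU1 : ∀ x k, |U x k| ≤ 1 := by
    rintro x (i | j) <;> simp [U, hu, hcl1]
  have hW1 : ∀ y k, |W y k| ≤ 1 := by
    rintro y (i | j) <;> simp [W, hv, hcl1]
  have hUc : ∀ k, Continuous fun x => U x k := by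
    rintro (i | j)
    exacts [hui i, continuous_const]
  have hWc : ∀ k, Continuous fun y => W y k := by
    rintro (i | j)
    exacts [continuous_const, hvj j]
  let c : (Σ n : ℕ, (Fin n → ι ⊕ κ)) → ℝ := fun e => p e.1 (fun k => Pi.single (e.2 k) 1)
  have hc : ∀ e, |c e| ≤ C / r' ^ e.1 := fun e => by
    refine ((p e.1).le_opNorm _).trans ?_
    simpa [Pi.norm_single] using hpC e.1
  let A : (Σ n : ℕ, (Fin n → ι ⊕ κ)) → X → ℝ := fun e x => q ^ e.1 * ∏ k, U x (e.2 k)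
  let B : (Σ n : ℕ, (Fin n → ι ⊕ κ)) → Y → ℝ := fun e y =>
    c e * (r' * q) ^ e.1 * ∏ k, W y (e.2 k)
  have hA : ∀ e x, |A e x| ≤ q ^ e.1 := fun e x => by
    simp only [A, abs_mul, abs_pow, abs_of_pos hq0, Finset.abs_prod]
    exact mul_le_of_le_one_right (by positivity)
      (Finset.prod_le_one (fun _ _ => abs_nonneg _) fun _ _ => hU1 _ _)
  have hB : ∀ e y, |B e y| ≤ C * q ^ e.1 := fun e y => by
    simp only [B, abs_mul, abs_pow, abs_of_pos hq0, abs_of_pos hr'0, Finset.abs_prod]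
    calc |c e| * (r' * q) ^ e.1 * ∏ k, |W y (e.2 k)|
        ≤ |c e| * (r' * q) ^ e.1 := mul_le_of_le_one_right (by positivity)
          (Finset.prod_le_one (fun _ _ => abs_nonneg _) fun _ _ => hW1 _ _)
      _ ≤ C / r' ^ e.1 * (r' * q) ^ e.1 := by gcongr; exact hc e
      _ = C * q ^ e.1 := by rw [mul_pow]; field_simp
  have hsq := summable_sigma_fin_pow (ι := ι ⊕ κ) hq0.le hdq
  have hAB : ∀ e x y, A e x * B e y = c e * ∏ k, (δ • w x y) (e.2 k) := fun e x y => by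
    simp only [A, B, Pi.smul_apply, smul_eq_mul, hUW, Finset.prod_mul_distrib, Finset.prod_const,
      Finset.card_univ, Fintype.card_fin, hδ, mul_pow]
    ring
  have hw1 : ∀ x y, ‖w x y‖ ≤ 1 := fun x y => by
    rw [pi_norm_le_iff_of_nonneg zero_le_one]
    intro k
    rw [hUW, Real.norm_eq_abs, abs_mul]
    exact mul_le_one₀ (hU1 _ _) (abs_nonneg _) (hW1 _ _)
  refine ⟨fun x y => f (z₀ + δ • w x y), of_hasSum (f := A) (g := B) (fun e => ?_) (fun e => ?_)
    hsq (hsq.mul_left C) hA hB fun x y => ?_, ?_⟩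
  · exact continuous_const.mul (continuous_finsetProd _ fun k _ => hUc _)
  · exact continuous_const.mul (continuous_finsetProd _ fun k _ => hWc _)
  · have hs : Summable fun e => A e x * B e y := by
      refine Summable.of_norm_bounded (hsq.mul_left C) fun e => ?_
      rw [Real.norm_eq_abs, abs_mul]
      calc |A e x| * |B e y| ≤ 1 * (C * q ^ e.1) :=
            mul_le_mul ((hA e x).trans (pow_le_one₀ hq0.le hq1)) (hB e y) (abs_nonneg _)
              zero_le_one
        _ = _ := one_mul _
    simp only [hAB] at hs ⊢
    refine FormalMultilinearSeries.hasSum_sigma_coord hs (hp.hasSum ?_)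
    have : ‖δ • w x y‖ ≤ r' := by
      rw [norm_smul, Real.norm_eq_abs, abs_of_pos hδ0]
      exact (mul_le_of_le_one_right hδ0.le (hw1 x y)).trans hδr
    rw [mem_eball_zero_iff]
    refine lt_of_le_of_lt ?_ hr'
    rw [← ofReal_norm, ← ENNReal.ofReal_coe_nnreal]
    exact ENNReal.ofReal_le_ofReal this
  · have h1 : ∀ᶠ x in 𝓝 x₀, ∀ i, |(a x i - a x₀ i) / δ| ≤ 1 := by
      refine eventually_all.2 fun i => ?_
      have h := ((continuous_apply i).comp ha).tendsto x₀
      filter_upwards [Metric.tendsto_nhds.1 h δ hδ0] with x hx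
      rw [abs_div, abs_of_pos hδ0, div_le_one hδ0]
      exact (Real.dist_eq _ _ ▸ hx).le
    have h2 : ∀ᶠ y in 𝓝 y₀, ∀ j, |(b y j - b y₀ j) / δ| ≤ 1 := by
      refine eventually_all.2 fun j => ?_
      have h := ((continuous_apply j).comp hb).tendsto y₀
      filter_upwards [Metric.tendsto_nhds.1 h δ hδ0] with y hy
      rw [abs_div, abs_of_pos hδ0, div_le_one hδ0]
      exact (Real.dist_eq _ _ ▸ hy).le
    rw [nhds_prod_eq]
    filter_upwards [h1.prod_mk h2] with z hz
    congr 1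
    funext k
    rcases k with i | j
    · simp [hz₀, hw, hu, hclid _ (hz.1 i), mul_div_cancel₀ _ hδ0.ne']
    · simp [hz₀, hw, hv, hclid _ (hz.2 j), mul_div_cancel₀ _ hδ0.ne']

/-! ### Gibbs matrices and optimal plans -/

namespace Sinkhorn

variable {n m : ℕ}

/-- The Gibbs matrix `exp (x i + y j - λ M i j)` of a pair of dual potentials `z = (x, y)`. -/
noncomputable def gibbsPlan (M : Matrix (Fin n) (Fin m) ℝ) (lam : ℝ) (z : Fin n ⊕ Fin m → ℝ) :
    Matrix (Fin n) (Fin m) ℝ :=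
  Matrix.of fun i j => Real.exp (z (.inl i) + z (.inr j) - lam * M i j)

/-- The difference `∑ x i - ∑ y j` of the total masses of the two dual potentials. It fixes the
gauge: the Gibbs matrix does not see the addition of `c` to `x` and of `-c` to `y`. -/
def gauge (z : Fin n ⊕ Fin m → ℝ) : ℝ := ∑ i, z (.inl i) - ∑ j, z (.inr j)

/-- The pairwise sums of the potentials together with the gauge. -/
def pairSums (n m : ℕ) : (Fin n ⊕ Fin m → ℝ) →ₗ[ℝ] (Fin n × Fin m → ℝ) × ℝ where
  toFun z := (fun p => z (.inl p.1) + z (.inr p.2), gauge z)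
  map_add' z w := by
    ext
    · simp only [Pi.add_apply, Prod.fst_add]
      ring
    · simp only [gauge, Pi.add_apply, Finset.sum_add_distrib, Prod.snd_add]
      ring
  map_smul' c z := by
    ext
    · simp only [Pi.smul_apply, smul_eq_mul, Prod.smul_fst, RingHom.id_apply]
      ring
    · simp only [gauge, Pi.smul_apply, smul_eq_mul, ← Finset.mul_sum, Prod.smul_snd,
        RingHom.id_apply]
      ring

theorem ker_pairSums (hn : 0 < n) (hm : 0 < m) : LinearMap.ker (pairSums n m) = ⊥ := by
  rw [LinearMap.ker_eq_bot']
  intro z hz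
  have h1 : ∀ i j, z (.inl i) + z (.inr j) = 0 := fun i j => congrFun (congrArg Prod.fst hz) (i, j)
  have h2 : gauge z = 0 := congrArg Prod.snd hz
  have hx : ∀ i, z (.inl i) = -z (.inr ⟨0, hm⟩) := fun i => by linarith [h1 i ⟨0, hm⟩]
  have hy : ∀ j, z (.inr j) = z (.inr ⟨0, hm⟩) := fun j => by
    linarith [h1 ⟨0, hn⟩ j, h1 ⟨0, hn⟩ ⟨0, hm⟩]
  have h0 : z (.inr ⟨0, hm⟩) = 0 := by
    simp only [gauge, hx] at h2
    rw [Finset.sum_congr rfl fun j _ => hy j] at h2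
    simp only [Finset.sum_const, Finset.card_univ, Fintype.card_fin, nsmul_eq_mul] at h2
    have hn' : (0 : ℝ) < n := by exact_mod_cast hn
    have hm' : (0 : ℝ) < m := by exact_mod_cast hm
    have : (n + m : ℝ) * z (.inr ⟨0, hm⟩) = 0 := by linarith
    exact (mul_eq_zero.1 this).resolve_left (by positivity)
  funext k
  rcases k with i | j
  · simp [hx i, h0]
  · simp [hy j, h0]

/-- The row sums and the column sums of the Gibbs matrix, corrected by the gauge, which makes
the map a local diffeomorphism. -/
noncomputable def marginalMap (M : Matrix (Fin n) (Fin m) ℝ) (lam : ℝ) (z : Fin n ⊕ Fin m → ℝ) :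
    Fin n ⊕ Fin m → ℝ :=
  Sum.elim (fun i => ∑ j, gibbsPlan M lam z i j + gauge z)
    (fun j => ∑ i, gibbsPlan M lam z i j - gauge z)

/-- Where the two prescribed marginals have the same mass, the gauge correction vanishes. -/
theorem gibbsPlan_mem_transportPolytope (M : Matrix (Fin n) (Fin m) ℝ) (lam : ℝ) (hn : 0 < n)
    {z : Fin n ⊕ Fin m → ℝ} {a : Fin n → ℝ} {b : Fin m → ℝ} (hab : ∑ i, a i = ∑ j, b j)
    (hz : marginalMap M lam z = Sum.elim a b) : gibbsPlan M lam z ∈ transportPolytope a b := by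
  have hr : ∀ i, ∑ j, gibbsPlan M lam z i j + gauge z = a i := fun i => congrFun hz (.inl i)
  have hc : ∀ j, ∑ i, gibbsPlan M lam z i j - gauge z = b j := fun j => congrFun hz (.inr j)
  have hg : gauge z = 0 := by
    rw [← Finset.sum_congr rfl fun i _ => hr i, ← Finset.sum_congr rfl fun j _ => hc j,
      Finset.sum_add_distrib, Finset.sum_sub_distrib, Finset.sum_comm] at hab
    simp only [Finset.sum_const, Finset.card_univ, Fintype.card_fin, nsmul_eq_mul] at hab
    have hn' : (0 : ℝ) < n := by exact_mod_cast hn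
    have hm' : (0 : ℝ) ≤ m := Nat.cast_nonneg m
    have : (n + m : ℝ) * gauge z = 0 := by linarith
    exact (mul_eq_zero.1 this).resolve_left (by positivity)
  refine ⟨fun i j => (Real.exp_pos _).le, fun i => ?_, fun j => ?_⟩
  · simpa [hg] using hr i
  · simpa [hg] using hc j

/-- Gibbs' inequality: the tangent line of `t log t` at `exp l` lies below the graph. -/
theorem mul_add_sub_exp_le_mul_log {t : ℝ} (ht : 0 ≤ t) (l : ℝ) :
    t * l + t - Real.exp l ≤ t * Real.log t := by
  rcases ht.eq_or_lt with rfl | ht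
  · simpa using (Real.exp_pos l).le
  · have h := Real.add_one_le_exp (l - Real.log t)
    rw [Real.exp_sub, Real.exp_log ht, le_div_iff₀ ht] at h
    linarith

/-- A Gibbs matrix is the optimal plan between its own marginals. -/
theorem isOptimalPlan_gibbsPlan (M : Matrix (Fin n) (Fin m) ℝ) {lam : ℝ} (hlam : 0 < lam)
    {z : Fin n ⊕ Fin m → ℝ} {a : Fin n → ℝ} {b : Fin m → ℝ}
    (hz : gibbsPlan M lam z ∈ transportPolytope a b) :
    IsOptimalPlan M lam a b (gibbsPlan M lam z) := by
  refine ⟨hz, fun T hT => ?_⟩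
  have hl : (0 : ℝ) < 1 / lam := by positivity
  set P := gibbsPlan M lam z with hP
  -- The terms with the potentials depend on the marginals only.
  have hlin : ∀ T ∈ transportPolytope a b, ∑ i, ∑ j, T i j * (z (.inl i) + z (.inr j)) =
      ∑ i, a i * z (.inl i) + ∑ j, b j * z (.inr j) := by
    intro T hT
    simp only [mul_add, Finset.sum_add_distrib]
    rw [Finset.sum_comm (f := fun i j => T i j * z (.inr j))]
    simp only [← Finset.sum_mul, hT.2.1, hT.2.2]
  have hPobj : regObjective M lam P =
      1 / lam * (∑ i, ∑ j, P i j * (z (.inl i) + z (.inr j)) - ∑ i, ∑ j, P i j) := by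
    rw [regObjective_eq]
    simp only [← Finset.sum_sub_distrib, Finset.mul_sum]
    refine Finset.sum_congr rfl fun i _ => Finset.sum_congr rfl fun j _ => ?_
    have : Real.log (P i j) = z (.inl i) + z (.inr j) - lam * M i j := by
      simp [hP, gibbsPlan]
    rw [this]
    field_simp
    ring
  have hTobj : 1 / lam * (∑ i, ∑ j, T i j * (z (.inl i) + z (.inr j)) - ∑ i, ∑ j, P i j) ≤
      regObjective M lam T := by
    rw [regObjective_eq]
    simp only [← Finset.sum_sub_distrib, Finset.mul_sum]
    refine Finset.sum_le_sum fun i _ => Finset.sum_le_sum fun j _ => ?_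
    have h := mul_le_mul_of_nonneg_left (mul_add_sub_exp_le_mul_log (hT.1 i j)
      (z (.inl i) + z (.inr j) - lam * M i j)) hl.le
    have hPij : P i j = Real.exp (z (.inl i) + z (.inr j) - lam * M i j) := rfl
    rw [hPij]
    refine le_trans (le_of_eq ?_) (add_le_add_right h _)
    field_simp
    ring
  rw [Set.mem_ofPred_eq, hPobj, hlin P hz, ← hlin T hT]
  exact hTobj

theorem plan_eq_gibbsPlan (M : Matrix (Fin n) (Fin m) ℝ) {lam : ℝ} (hlam : 0 < lam)
    {z : Fin n ⊕ Fin m → ℝ} {a : Fin n → ℝ} {b : Fin m → ℝ}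
    (ha : a ∈ stdSimplex ℝ (Fin n)) (hb : b ∈ stdSimplex ℝ (Fin m))
    (hz : gibbsPlan M lam z ∈ transportPolytope a b) : plan M lam a b = gibbsPlan M lam z :=
  (existsUnique_isOptimalPlan M hlam ha hb).unique (isOptimalPlan_plan M hlam ha hb)
    (isOptimalPlan_gibbsPlan M hlam hz)

/-! ### Regularity and derivative of the marginal map -/

theorem contDiff_gibbsPlan_apply (M : Matrix (Fin n) (Fin m) ℝ) (lam : ℝ) (i : Fin n) (j : Fin m) :
    ContDiff ℝ ω fun z => gibbsPlan M lam z i j := by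
  simp only [gibbsPlan, Matrix.of_apply]
  fun_prop

theorem contDiff_gauge : ContDiff ℝ ω (gauge : (Fin n ⊕ Fin m → ℝ) → ℝ) := by
  unfold gauge
  fun_prop

theorem contDiff_marginalMap (M : Matrix (Fin n) (Fin m) ℝ) (lam : ℝ) :
    ContDiff ℝ ω (marginalMap M lam) := by
  rw [contDiff_pi]
  rintro (i | j)
  · exact (ContDiff.sum fun j _ => contDiff_gibbsPlan_apply M lam i j).add contDiff_gauge
  · exact (ContDiff.sum fun i _ => contDiff_gibbsPlan_apply M lam i j).sub contDiff_gauge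

theorem gauge_add_smul (z v : Fin n ⊕ Fin m → ℝ) (t : ℝ) :
    gauge (z + t • v) = gauge z + t * gauge v := by
  simp only [gauge, Pi.add_apply, Pi.smul_apply, smul_eq_mul, Finset.sum_add_distrib,
    ← Finset.mul_sum]
  ring

theorem hasDerivAt_gauge_line (z v : Fin n ⊕ Fin m → ℝ) :
    HasDerivAt (fun t : ℝ => gauge (z + t • v)) (gauge v) 0 := by
  simp only [gauge_add_smul]
  simpa using ((hasDerivAt_id (0 : ℝ)).mul_const (gauge v)).const_add (gauge z)

theorem hasDerivAt_gibbsPlan_line (M : Matrix (Fin n) (Fin m) ℝ) (lam : ℝ)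
    (z v : Fin n ⊕ Fin m → ℝ) (i : Fin n) (j : Fin m) :
    HasDerivAt (fun t : ℝ => gibbsPlan M lam (z + t • v) i j)
      (gibbsPlan M lam z i j * (v (.inl i) + v (.inr j))) 0 := by
  have h : HasDerivAt (fun t : ℝ => (z (.inl i) + t * v (.inl i)) + (z (.inr j) + t * v (.inr j))
      - lam * M i j) (v (.inl i) + v (.inr j)) 0 := by
    have h1 := ((hasDerivAt_id (0 : ℝ)).mul_const (v (.inl i))).const_add (z (.inl i))
    have h2 := ((hasDerivAt_id (0 : ℝ)).mul_const (v (.inr j))).const_add (z (.inr j))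
    simpa using (h1.add h2).sub_const (lam * M i j)
  simpa [gibbsPlan] using h.exp

theorem sum_mul_marginalMap (M : Matrix (Fin n) (Fin m) ℝ) (lam : ℝ) (z v : Fin n ⊕ Fin m → ℝ) :
    ∑ k, v k * marginalMap M lam z k =
      ∑ i, ∑ j, gibbsPlan M lam z i j * (v (.inl i) + v (.inr j)) + gauge z * gauge v := by
  simp only [Fintype.sum_sum_type, marginalMap, Sum.elim_inl, Sum.elim_inr, mul_add, mul_sub,
    Finset.sum_add_distrib, Finset.sum_sub_distrib, Finset.mul_sum]
  rw [Finset.sum_comm (f := fun j i => v (.inr j) * gibbsPlan M lam z i j), gauge, gauge]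
  simp only [← Finset.sum_mul, mul_comm (gibbsPlan M lam z _ _)]
  ring

/-- The derivative of the corrected marginal map is symmetric, with quadratic form
`∑ P i j * (v i + w j)² + (∑ v i - ∑ w j)²`; hence it is positive definite. -/
theorem fderiv_marginalMap_injective (M : Matrix (Fin n) (Fin m) ℝ) (lam : ℝ) (hn : 0 < n)
    (hm : 0 < m) (z : Fin n ⊕ Fin m → ℝ) :
    Function.Injective (fderiv ℝ (marginalMap M lam) z) := by
  rw [injective_iff_map_eq_zero]
  intro v hv
  have hline : HasDerivAt (fun t : ℝ => z + t • v) v 0 := by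
    simpa using ((hasDerivAt_id (0 : ℝ)).smul_const v).const_add z
  have hd : HasDerivAt (fun t : ℝ => marginalMap M lam (z + t • v)) 0 0 := by
    have h1 : HasFDerivAt (marginalMap M lam) (fderiv ℝ (marginalMap M lam) z)
        (z + (0 : ℝ) • v) := by
      rw [zero_smul, add_zero]
      exact ((contDiff_marginalMap M lam).differentiable (by simp) z).hasFDerivAt
    rw [← hv]
    exact h1.comp_hasDerivAt 0 hline
  -- The pairing of `v` with its image under the derivative, computed in two ways.
  have hd1 : HasDerivAt (fun t : ℝ => ∑ k, v k * marginalMap M lam (z + t • v) k) 0 0 := by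
    have := HasDerivAt.fun_sum (u := Finset.univ) fun k _ =>
      ((hasDerivAt_pi.1 hd) k).const_mul (v k)
    simpa using this
  simp only [sum_mul_marginalMap] at hd1
  have hd2 := (HasDerivAt.fun_sum (u := Finset.univ) fun i _ =>
    HasDerivAt.fun_sum (u := Finset.univ) fun j _ =>
      (hasDerivAt_gibbsPlan_line M lam z v i j).mul_const (v (.inl i) + v (.inr j))).add
    ((hasDerivAt_gauge_line z v).mul_const (gauge v))
  have h0 := hd2.unique hd1
  have hnn : ∀ i j, 0 ≤ gibbsPlan M lam z i j * (v (.inl i) + v (.inr j)) *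
      (v (.inl i) + v (.inr j)) := fun i j => by
    rw [mul_assoc]
    exact mul_nonneg (Real.exp_pos _).le (mul_self_nonneg _)
  have hnn' := fun i => Finset.sum_nonneg fun j (_ : j ∈ Finset.univ) => hnn i j
  rw [add_eq_zero_iff_of_nonneg (Finset.sum_nonneg fun i _ => hnn' i) (mul_self_nonneg _),
    Finset.sum_eq_zero_iff_of_nonneg fun i _ => hnn' i] at h0
  refine (LinearMap.ker_eq_bot'.1 (ker_pairSums hn hm)) v (Prod.ext ?_ (mul_self_eq_zero.1 h0.2))
  funext ⟨i, j⟩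
  have := (Finset.sum_eq_zero_iff_of_nonneg fun j _ => hnn i j).1 (h0.1 i (Finset.mem_univ i)) j
    (Finset.mem_univ j)
  rw [mul_assoc] at this
  exact mul_self_eq_zero.1 ((mul_eq_zero.1 this).resolve_left (Real.exp_pos _).ne')

/-! ### Existence and analyticity of the dual potentials -/

/-- The coercivity of `exp (t - μ) - c t`. -/
theorem exists_mul_abs_sub_le_exp_sub {c : ℝ} (hc : 0 < c) (μ : ℝ) :
    ∃ K : ℝ, ∀ t, c * |t| - K ≤ Real.exp (t - μ) - c * t := by
  refine ⟨|2 * c * (1 - μ - Real.log (2 * c))|, fun t => ?_⟩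
  rcases le_total t 0 with ht | ht
  · rw [abs_of_nonpos ht]
    have := abs_nonneg (2 * c * (1 - μ - Real.log (2 * c)))
    linarith [Real.exp_pos (t - μ)]
  · -- The tangent line with slope `2 c` leaves a surplus of slope `c`.
    rw [abs_of_nonneg ht]
    have h := mul_le_mul_of_nonneg_left (Real.add_one_le_exp (t - μ - Real.log (2 * c)))
      (by positivity : 0 ≤ 2 * c)
    rw [Real.exp_sub, Real.exp_log (by positivity), mul_div_cancel₀ _ (by positivity)] at h
    linarith [neg_abs_le (2 * c * (1 - μ - Real.log (2 * c)))]

/-- The dual objective of entropic transport from `a` to `b`, with the square of the gauge added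
to remove the invariant direction. -/
noncomputable def dualObjective (M : Matrix (Fin n) (Fin m) ℝ) (lam : ℝ) (a : Fin n → ℝ)
    (b : Fin m → ℝ) (z : Fin n ⊕ Fin m → ℝ) : ℝ :=
  ∑ i, ∑ j, gibbsPlan M lam z i j + gauge z ^ 2 / 2 - ∑ k, z k * Sum.elim a b k

theorem continuous_dualObjective (M : Matrix (Fin n) (Fin m) ℝ) (lam : ℝ) (a : Fin n → ℝ)
    (b : Fin m → ℝ) : Continuous (dualObjective M lam a b) := by
  unfold dualObjective
  have h1 := fun i j => (contDiff_gibbsPlan_apply M lam i j).continuous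
  have h2 := (contDiff_gauge (n := n) (m := m)).continuous
  fun_prop

/-- For marginals of mass one the dual objective is a sum of functions of the single numbers
`x i + y j` and of the gauge, each of them coercive. -/
theorem tendsto_dualObjective (M : Matrix (Fin n) (Fin m) ℝ) (lam : ℝ) {a : Fin n → ℝ}
    {b : Fin m → ℝ} (ha : a ∈ stdSimplex ℝ (Fin n)) (hb : b ∈ stdSimplex ℝ (Fin m))
    {ε : ℝ} (hε : 0 < ε) (haε : ∀ i, ε ≤ a i) (hbε : ∀ j, ε ≤ b j) (hn : 0 < n) (hm : 0 < m) :
    Tendsto (dualObjective M lam a b) (cocompact _) atTop := by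
  have hc : ∀ i j, 0 < a i * b j := fun i j =>
    mul_pos (hε.trans_le (haε i)) (hε.trans_le (hbε j))
  choose K hK using fun i j => exists_mul_abs_sub_le_exp_sub (hc i j) (lam * M i j)
  set κ := ε * ε with hκ
  have hκ0 : 0 < κ := by positivity
  have hlow : ∀ z, κ * ‖pairSums n m z‖ - (∑ i, ∑ j, K i j + κ ^ 2 / 2) ≤
      dualObjective M lam a b z := by
    intro z
    -- Both marginals have mass one, so the linear term depends on the pairwise sums only.
    have hlin : ∑ k, z k * Sum.elim a b k =
        ∑ i, ∑ j, a i * b j * (z (.inl i) + z (.inr j)) := by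
      simp only [Fintype.sum_sum_type, Sum.elim_inl, Sum.elim_inr, mul_add,
        Finset.sum_add_distrib]
      rw [Finset.sum_comm (f := fun i j => a i * b j * z (.inr j))]
      simp only [← Finset.sum_mul, ← Finset.mul_sum, ha.2, hb.2, mul_one, mul_comm]
    have h1 : κ * ∑ i, ∑ j, |z (.inl i) + z (.inr j)| - ∑ i, ∑ j, K i j ≤
        ∑ i, ∑ j, gibbsPlan M lam z i j - ∑ k, z k * Sum.elim a b k := by
      rw [hlin]
      simp only [Finset.mul_sum, ← Finset.sum_sub_distrib]
      refine Finset.sum_le_sum fun i _ => Finset.sum_le_sum fun j _ =>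
        le_trans ?_ (hK i j (z (.inl i) + z (.inr j)))
      have : κ ≤ a i * b j := mul_le_mul (haε i) (hbε j) hε.le (hε.le.trans (haε i))
      gcongr
    have h2 : κ * |gauge z| - κ ^ 2 / 2 ≤ gauge z ^ 2 / 2 := by
      rw [← sq_abs (gauge z)]
      linarith [sq_nonneg (|gauge z| - κ)]
    have h3 : ‖pairSums n m z‖ ≤ ∑ i, ∑ j, |z (.inl i) + z (.inr j)| + |gauge z| := by
      have hS : 0 ≤ ∑ i, ∑ j, |z (.inl i) + z (.inr j)| := by positivity
      rw [Prod.norm_def]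
      refine max_le ?_ (le_add_of_nonneg_left hS)
      rw [pi_norm_le_iff_of_nonneg (by positivity)]
      rintro ⟨i, j⟩
      refine le_trans ?_ (le_add_of_nonneg_right (abs_nonneg _))
      exact (Finset.single_le_sum (f := fun j => |z (.inl i) + z (.inr j)|)
        (fun _ _ => abs_nonneg _) (Finset.mem_univ j)).trans
        (Finset.single_le_sum (f := fun i => ∑ j, |z (.inl i) + z (.inr j)|)
        (fun _ _ => Finset.sum_nonneg fun _ _ => abs_nonneg _) (Finset.mem_univ i))
    have h4 := mul_le_mul_of_nonneg_left h3 hκ0.le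
    rw [dualObjective]
    linarith
  refine tendsto_atTop_mono hlow (tendsto_atTop_add_const_right _ _ ?_)
  exact (tendsto_norm_cocompact_atTop.comp (LinearMap.isClosedEmbedding_of_injective
    (ker_pairSums hn hm)).tendsto_cocompact).const_mul_atTop hκ0

/-- The critical points of the dual objective solve the marginal equations. -/
theorem marginalMap_eq_of_forall_dualObjective_le (M : Matrix (Fin n) (Fin m) ℝ) (lam : ℝ)
    {a : Fin n → ℝ} {b : Fin m → ℝ} {z : Fin n ⊕ Fin m → ℝ}
    (hz : ∀ w, dualObjective M lam a b z ≤ dualObjective M lam a b w) :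
    marginalMap M lam z = Sum.elim a b := by
  -- The direction is the gradient itself, along which the derivative is its squared norm.
  set v : Fin n ⊕ Fin m → ℝ := marginalMap M lam z - Sum.elim a b with hv
  have hd : HasDerivAt (fun t : ℝ => dualObjective M lam a b (z + t • v))
      (∑ k, v k * marginalMap M lam z k - ∑ k, v k * Sum.elim a b k) 0 := by
    have h1 := HasDerivAt.fun_sum (u := Finset.univ) fun i _ =>
      HasDerivAt.fun_sum (u := Finset.univ) fun j _ => hasDerivAt_gibbsPlan_line M lam z v i j
    have h2 := ((hasDerivAt_gauge_line z v).pow 2).div_const 2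
    have h3 : HasDerivAt (fun t : ℝ => ∑ k, (z + t • v) k * Sum.elim a b k)
        (∑ k, v k * Sum.elim a b k) 0 := HasDerivAt.fun_sum fun k _ => by
      have := ((hasDerivAt_id (0 : ℝ)).mul_const (v k)).const_add (z k)
      simpa using this.mul_const (Sum.elim a b k)
    rw [sum_mul_marginalMap]
    refine ((h1.add h2).sub h3).congr_deriv ?_
    simp
    ring
  have hmin : IsLocalMin (fun t : ℝ => dualObjective M lam a b (z + t • v)) 0 :=
    Eventually.of_forall fun t => by simpa using hz (z + t • v)
  have h0 := hmin.hasDerivAt_eq_zero hd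
  rw [← Finset.sum_sub_distrib] at h0
  have h1 : ∑ k, v k * v k = 0 := by
    rw [← h0]
    exact Finset.sum_congr rfl fun k _ => by
      rw [← mul_sub]
      rfl
  rw [Finset.sum_eq_zero_iff_of_nonneg fun k _ => mul_self_nonneg _] at h1
  rw [← sub_eq_zero]
  funext k
  exact mul_self_eq_zero.1 (h1 k (Finset.mem_univ k))

/-- Near a pair of positive marginals the dual potentials can be chosen as analytic functions of
the marginals. -/
theorem exists_analyticAt_rightInverse_marginalMap (M : Matrix (Fin n) (Fin m) ℝ) (lam : ℝ)
    {a : Fin n → ℝ} {b : Fin m → ℝ} (ha : a ∈ stdSimplex ℝ (Fin n)) (hb : b ∈ stdSimplex ℝ (Fin m))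
    {ε : ℝ} (hε : 0 < ε) (haε : ∀ i, ε ≤ a i) (hbε : ∀ j, ε ≤ b j) (hn : 0 < n) (hm : 0 < m) :
    ∃ g : (Fin n ⊕ Fin m → ℝ) → Fin n ⊕ Fin m → ℝ, AnalyticAt ℝ g (Sum.elim a b) ∧
      ∀ᶠ p in 𝓝 (Sum.elim a b), marginalMap M lam (g p) = p := by
  obtain ⟨z, hz⟩ := (continuous_dualObjective M lam a b).exists_forall_le
    (tendsto_dualObjective M lam ha hb hε haε hbε hn hm)
  have hab := marginalMap_eq_of_forall_dualObjective_le M lam hz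
  have hG : ContDiffAt ℝ ω (marginalMap M lam) z := (contDiff_marginalMap M lam).contDiffAt
  let e : (Fin n ⊕ Fin m → ℝ) ≃L[ℝ] (Fin n ⊕ Fin m → ℝ) :=
    (LinearEquiv.ofInjectiveEndo (fderiv ℝ (marginalMap M lam) z).toLinearMap
      (fderiv_marginalMap_injective M lam hn hm z)).toContinuousLinearEquiv
  have he : HasFDerivAt (marginalMap M lam) (e : (Fin n ⊕ Fin m → ℝ) →L[ℝ] _) z :=
    (hG.differentiableAt (by simp)).hasFDerivAt
  rw [← hab]
  exact ⟨hG.localInverse he (by simp), (hG.to_localInverse he (by simp)).analyticAt,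
    (hG.hasStrictFDerivAt' he (by simp)).eventually_right_inverse⟩

/-! ### The Sinkhorn losses -/

theorem regularizedSinkhorn_eq (M : Matrix (Fin n) (Fin m) ℝ) {lam : ℝ} (hlam : 0 < lam)
    {a : Fin n → ℝ} {b : Fin m → ℝ} (ha : a ∈ stdSimplex ℝ (Fin n))
    (hb : b ∈ stdSimplex ℝ (Fin m)) :
    regularizedSinkhorn M lam a b = regObjective M lam (plan M lam a b) := by
  have h := isOptimalPlan_plan M hlam ha hb
  refine (isLeast_regularizedSinkhorn M hlam ha hb).unique ⟨⟨_, h.1, rfl⟩, ?_⟩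
  rintro _ ⟨T, hT, rfl⟩
  exact h.2 hT

theorem isCompact_truncSimplex (n : ℕ) (ε : ℝ) : IsCompact (truncSimplex n ε) := by
  have : truncSimplex n ε = stdSimplex ℝ (Fin n) ∩ ⋂ i, {p : Fin n → ℝ | ε ≤ p i} := by
    ext p
    simp [truncSimplex]
  rw [this]
  exact (isCompact_stdSimplex ℝ (Fin n)).inter_right
    (isClosed_iInter fun i => isClosed_le continuous_const (continuous_apply i))

/-- Every observable of the optimal plan that is analytic in the dual potentials is a structure
encoding loss. -/
theorem isSELF_comp_plan (M : Matrix (Fin n) (Fin n) ℝ) {lam : ℝ} (hlam : 0 < lam) {ε : ℝ}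
    (hε : 0 < ε) {J : Matrix (Fin n) (Fin n) ℝ → ℝ}
    (hJ : ContDiff ℝ ω fun z => J (gibbsPlan M lam z)) :
    IsSELF fun a b : truncSimplex n ε => J (plan M lam (a : Fin n → ℝ) (b : Fin n → ℝ)) := by
  have : CompactSpace (truncSimplex n ε) := isCompact_iff_compactSpace.1 (isCompact_truncSimplex n ε)
  refine HilbertFactorable.isSELF (HilbertFactorable.of_locally fun ⟨a₀, b₀⟩ => ?_)
  have hn : 0 < n := by
    rcases Nat.eq_zero_or_pos n with rfl | hn
    · simpa using a₀.2.1.2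
    · exact hn
  obtain ⟨g, hg, hgG⟩ := exists_analyticAt_rightInverse_marginalMap M lam a₀.2.1 b₀.2.1 hε
    a₀.2.2 b₀.2.2 hn hn
  obtain ⟨T, hT, hST⟩ := HilbertFactorable.exists_eventually_eq_of_analyticAt
    (X := truncSimplex n ε) (Y := truncSimplex n ε) (a := Subtype.val) (b := Subtype.val)
    continuous_subtype_val continuous_subtype_val (x₀ := a₀) (y₀ := b₀)
    (f := fun p => J (gibbsPlan M lam (g p))) (hJ.contDiffAt.analyticAt.comp hg)
  have hcont : Continuous fun w : truncSimplex n ε × truncSimplex n ε =>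
      (Sum.elim (w.1 : Fin n → ℝ) (w.2 : Fin n → ℝ) : Fin n ⊕ Fin n → ℝ) := by
    refine continuous_pi ?_
    rintro (i | j)
    · exact (continuous_apply i).comp (continuous_subtype_val.comp continuous_fst)
    · exact (continuous_apply j).comp (continuous_subtype_val.comp continuous_snd)
  refine ⟨T, hT, ?_⟩
  filter_upwards [hST, (hcont.tendsto (a₀, b₀)).eventually hgG] with w hw hwG
  rw [← hw, plan_eq_gibbsPlan M hlam w.1.2.1 w.2.2.1
    (gibbsPlan_mem_transportPolytope M lam hn (w.1.2.1.2.trans w.2.2.1.2.symm) hwG)]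

end Sinkhorn

theorem mainTheorem6 (n : ℕ) (M : Matrix (Fin n) (Fin n) ℝ) (lam : ℝ) (hlam : 0 < lam)
    (ε : ℝ) (hε : 0 < ε) :
    Sinkhorn.IsSELF (fun a b : Sinkhorn.truncSimplex n ε =>
      Sinkhorn.regularizedSinkhorn M lam (a : Fin n → ℝ) (b : Fin n → ℝ)) ∧
    Sinkhorn.IsSELF (fun a b : Sinkhorn.truncSimplex n ε =>
      Sinkhorn.sharpSinkhorn M lam (a : Fin n → ℝ) (b : Fin n → ℝ)) := by
  constructor
  · have h : (fun a b : Sinkhorn.truncSimplex n ε =>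
        Sinkhorn.regularizedSinkhorn M lam (a : Fin n → ℝ) (b : Fin n → ℝ)) =
        fun a b : Sinkhorn.truncSimplex n ε =>
        Sinkhorn.regObjective M lam (Sinkhorn.plan M lam (a : Fin n → ℝ) (b : Fin n → ℝ)) := by
      funext a b
      exact Sinkhorn.regularizedSinkhorn_eq M hlam a.2.1 b.2.1
    rw [h]
    refine Sinkhorn.isSELF_comp_plan M hlam hε ?_
    -- On Gibbs matrices the logarithm in the entropy cancels the exponential.
    simp only [Sinkhorn.regObjective_eq, Sinkhorn.gibbsPlan, Matrix.of_apply, Real.log_exp]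
    fun_prop
  · refine Sinkhorn.isSELF_comp_plan M hlam hε (J := fun T => Sinkhorn.frobenius T M) ?_
    simp only [Sinkhorn.frobenius, Matrix.trace, Matrix.diag, Matrix.mul_apply,
      Matrix.transpose_apply, Sinkhorn.gibbsPlan, Matrix.of_apply]
    fun_prop
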